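/- Let $K$ be a commutative ring and let $\mathcal{P}$ be the set of all integer partitions, identified with their Young diagrams. For $\mu\subset\lambda$ in $\mathcal{P}$, a reverse plane partition of shape $\lambda/\mu$ is a filling of the boxes of $\lambda/\mu$ with positive integers that increases weakly along every row and every column. The dual stable Grothendieck polynomial is $$g_{\lambda/\mu}=\sum_T\prod_{i\ge1}x_i^{T(i)}\in K[[x_1,x_2,\dots]],$$ the sum over all reverse plane partitions $T$ of shape $\lambda/\mu$, where $T(i)$ is the number of columns of $T$ that contain $i$. Put $g_\lambda=g_{\lambda/\emptyset}$. Let $c(\lambda/\mu)$ be the number of columns of $\lambda/\mu$ that contain at least one box, and $c(\lambda)=c(\lambda/\emptyset)$. (1) For all $\mu,\nu\in\mathcal{P}$ there is exactly one family $(d^{\lambda}_{\mu\nu})_{\lambda\in\mathcal{P}}$ in $K$ with finitely many nonzero members such that $g_\mu g_\nu=\sum_\lambda d^{\lambda}_{\mu\nu}g_\lambda$, and it satisfies $$\sum_\lambda d^{\lambda}_{\mu\nu}=1,\qquad \sum_\lambda d^{\lambda}_{\mu\nu}\,t^{c(\lambda)}=t^{c(\mu)+c(\nu)}\quad\text{for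 every }t\in K.$$ (2) For all $\lambda,\mu\in\mathcal{P}$ with $\mu\subset\lambda$ there is exactly one family $(c^{\lambda}_{\mu\nu})_{\nu\in\mathcal{P}}$ in $K$ with finitely many nonzero members such that $g_{\lambda/\mu}=\sum_\nu c^{\lambda}_{\mu\nu}g_\nu$, and it satisfies $$\sum_\nu c^{\lambda}_{\mu\nu}=1,\qquad \sum_\nu c^{\lambda}_{\mu\nu}\,t^{c(\nu)}=t^{c(\lambda/\mu)}\quad\text{for every }t\in K.$$ -/

import Mathlib

/-- The boxes of the skew shape `lam/mu` (used for `mu ≤ lam`, i.e. `mu ⊆ lam`).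
A box `(i, j)` lies in row `i` and column `j`. -/
def skewCells (lam mu : YoungDiagram) : Finset (ℕ × ℕ) := lam.cells \ mu.cells

/-- `c(lam/mu)`, the number of (nonempty) columns of the skew shape `lam/mu`. -/
def numColumns (lam mu : YoungDiagram) : ℕ := ((skewCells lam mu).image Prod.snd).card

/-- A filling of the boxes of `lam/mu` is a reverse plane partition if the entries increase weakly
along every row and along every column. The letters `1 < 2 < 3 < ⋯` are encoded as the natural
numbers `0 < 1 < 2 < ⋯`. -/
def IsReversePlanePartition {lam mu : YoungDiagram} (T : skewCells lam mu → ℕ) : Prop :=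
  (∀ a b : skewCells lam mu, a.1.1 = b.1.1 → a.1.2 ≤ b.1.2 → T a ≤ T b) ∧
  (∀ a b : skewCells lam mu, a.1.2 = b.1.2 → a.1.1 ≤ b.1.1 → T a ≤ T b)

/-- The exponent of the monomial `x^T`: the exponent of `x_k` is the number of columns of `T`
that contain the letter `k`. -/
noncomputable def rppWeight {lam mu : YoungDiagram} (T : skewCells lam mu → ℕ) : ℕ →₀ ℕ :=
  Finsupp.onFinset (Finset.univ.image T)
    (fun k => ((Finset.univ.filter (fun a => T a = k)).image (fun a => a.1.2)).card)
    (by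
      intro k hk
      rw [Finset.card_ne_zero] at hk
      obtain ⟨_, hj⟩ := hk
      obtain ⟨a, ha, _⟩ := Finset.mem_image.1 hj
      exact Finset.mem_image.2 ⟨a, Finset.mem_univ a, (Finset.mem_filter.1 ha).2⟩)

/-- Only finitely many fillings contribute to a given monomial. -/
theorem finite_rppWeight_eq (lam mu : YoungDiagram) (m : ℕ →₀ ℕ) :
    {T : skewCells lam mu → ℕ | IsReversePlanePartition T ∧ rppWeight T = m}.Finite := by
  refine (Set.Finite.pi' (fun _ : skewCells lam mu => m.support.finite_toSet)).subset ?_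
  rintro T ⟨_, rfl⟩ a
  rw [Finset.mem_coe, Finsupp.mem_support_iff]
  exact Finset.card_ne_zero.2
    ⟨a.1.2, Finset.mem_image.2 ⟨a, Finset.mem_filter.2 ⟨Finset.mem_univ a, rfl⟩, rfl⟩⟩

/-- The dual stable Grothendieck polynomial `g_{lam/mu} = ∑_T x^T`, the sum running over all
reverse plane partitions `T` of shape `lam/mu`, as a formal power series in the variables
`x_0, x_1, x_2, …` over `K`. -/
noncomputable def dualGrothendieck (K : Type*) [CommRing K] (lam mu : YoungDiagram) :
    MvPowerSeries ℕ K := fun m =>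
  (({T : skewCells lam mu → ℕ | IsReversePlanePartition T ∧ rppWeight T = m}.ncard : ℕ) : K)

/-- `a` is the (finite) family of coefficients of an expansion `f = ∑_lam a_lam g_lam`, where
`g_lam = g_{lam/∅}`. -/
def IsExpansion {K : Type*} [CommRing K] (f : MvPowerSeries ℕ K) (a : YoungDiagram →₀ K) : Prop :=
  f = a.sum (fun lam r => r • dualGrothendieck K lam ⊥)

/-! Keep only the variable `x_0`: the one surviving filling is constant, so `g_{lam/mu}` becomes
`x_0 ^ c(lam/mu)` (`coeff_single_zero_dualGrothendieck`). Applied to an expansion this gives the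
identity in `t`, and `t = 1` gives the coefficient sum (`IsExpansion.sum_eq`).

What remains is that expansions exist and are unique. The lexicographically largest exponent of
`g_lam` is the sequence of row lengths of `lam`, with coefficient 1. Hence the `g_lam` are linearly
independent over any `K`, and subtracting leading terms expands every symmetric series of bounded
degree (`IsSymmetricSeries.exists_isExpansion`).

The main work is the symmetry of `g_{lam/mu}`. A filling is a growing chain of diagrams, so
exchanging two adjacent exponents comes down to one middle diagram: for fixed `α ≤ β`, the number of
`ν` between them with `s` columns in `ν/α` and `t` in `β/ν` must be symmetric in `s` and `t`. In
terms of column lengths the generating function is `transferSum`, and its symmetry in `x` and `y`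
follows from a closed form propagated column by column (`exists_transferSum_eq`). -/

/-! ### Symmetry of a two-variable sum over bounded decreasing sequences. -/

section Transfer

variable {R : Type*} [CommRing R]

/-- The sum of the weights of all weakly decreasing sequences `p_0 ≥ ⋯ ≥ p_{k-1} ≥ q` with
`a_j ≤ p_j ≤ b_j`, where each `j` contributes a factor `x` if `a_j < p_j` and a factor `y` if
`p_j < b_j`. -/
def transferSum (a b : ℕ → ℕ) (x y : R) : ℕ → ℕ → R
  | 0, _ => 1
  | k + 1, q => ∑ p ∈ Finset.Icc (max q (a k)) (b k),
      (if a k < p then x else 1) * (if p < b k then y else 1) * transferSum a b x y k p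

/-- The closed form survives one more summation. For `A < q ≤ B` the hypotheses give `H q = E' q - y
* E q`, so the sum telescopes downwards from `q = B`; for `A < B` the value at `B` is what dictates
`Z'`. -/
theorem transfer_step {A B : ℕ} (hAB : A ≤ B) (x y Z Z' : R) (E E' H : ℕ → R)
    (hE : ∀ q ≤ A, E q = 0)
    (hH : ∀ q ≤ B, H q = Z - y * E q - x * y * ∑ p ∈ Finset.range q, E p)
    (hE'0 : ∀ q ≤ A, E' q = 0)
    (hE'1 : ∀ q, A < q → E' q = Z - x * y * ∑ p ∈ Finset.range q, E p)
    (hZ'0 : A = B → Z' = Z)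
    (hZ'1 : A < B → Z' = (x + y) * E' B - x * y * E B + x * y * ∑ p ∈ Finset.range B, E' p)
    {q : ℕ} (hq : q ≤ B) :
    ∑ p ∈ Finset.Icc (max q A) B,
        (if A < p then x else 1) * (if p < B then y else 1) * H p =
      Z' - y * E' q - x * y * ∑ p ∈ Finset.range q, E' p := by
  have sum0 : ∀ (F : ℕ → R), (∀ q ≤ A, F q = 0) → ∀ q ≤ A + 1,
      ∑ p ∈ Finset.range q, F p = 0 := fun F hF q hq =>
    Finset.sum_eq_zero fun p hp => hF p (by have := Finset.mem_range.1 hp; omega)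
  induction hq using Nat.decreasingInduction with
  | self =>
    rw [max_eq_left hAB, Finset.Icc_self, Finset.sum_singleton, if_neg (lt_irrefl B),
      hH B le_rfl]
    rcases hAB.eq_or_lt with h | h
    · rw [if_neg (by omega), hZ'0 h, hE B (by omega), hE'0 B (by omega), sum0 E hE B (by omega),
        sum0 E' hE'0 B (by omega)]
      ring
    · rw [if_pos h, hZ'1 h, hE'1 B h]
      ring
  | of_succ q hqB ih =>
    rcases lt_trichotomy q A with h | h | h
    · rw [max_eq_right (by omega : q + 1 ≤ A)] at ih
      rw [max_eq_right h.le, ih, hE'0 _ h.le, hE'0 _ (by omega : q + 1 ≤ A),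
        sum0 E' hE'0 _ (by omega), sum0 E' hE'0 _ (by omega)]
    · subst h
      rw [max_eq_left (by omega : q ≤ q + 1)] at ih
      rw [max_self, ← Finset.insert_Icc_add_one_left_eq_Icc hAB, Finset.sum_insert (by simp), ih,
        if_neg (lt_irrefl q), if_pos hqB, hH q hAB, hE q le_rfl, sum0 E hE q (by omega),
        hE'0 q le_rfl, hE'1 (q + 1) (by omega), sum0 E hE _ le_rfl, sum0 E' hE'0 _ le_rfl,
        sum0 E' hE'0 q (by omega)]
      ring
    · rw [max_eq_left (by omega : A ≤ q + 1)] at ih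
      rw [max_eq_left h.le, ← Finset.insert_Icc_add_one_left_eq_Icc hqB.le,
        Finset.sum_insert (by simp), ih, if_pos h, if_pos hqB, hH q hqB.le,
        hE'1 (q + 1) (by omega), Finset.sum_range_succ, Finset.sum_range_succ, hE'1 q h]
      ring

/-- The point is that the same `E` and `Z` serve both orders of `x` and `y`: only the coefficient of
`E q` breaks the symmetry, and `E` vanishes at `q = 0`. -/
theorem exists_transferSum_eq {a b : ℕ → ℕ} (ha : Antitone a) (hb : Antitone b)
    (hab : ∀ j, a j ≤ b j) (x y : R) (k : ℕ) :
    ∃ (E : ℕ → R) (Z : R), (∀ q ≤ a k, E q = 0) ∧ ∀ q ≤ b k,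
      transferSum a b x y k q = Z - y * E q - x * y * ∑ p ∈ Finset.range q, E p ∧
      transferSum a b y x k q = Z - x * E q - y * x * ∑ p ∈ Finset.range q, E p := by
  induction k with
  | zero => exact ⟨0, 1, by simp [transferSum]⟩
  | succ k ih =>
    obtain ⟨E, Z, hE, hH⟩ := ih
    let E' : ℕ → R := fun q => if a k < q then Z - x * y * ∑ p ∈ Finset.range q, E p else 0
    let Z' : R := if a k = b k then Z else
      (x + y) * E' (b k) - x * y * E (b k) + x * y * ∑ p ∈ Finset.range (b k), E' p
    have hE'0 : ∀ q ≤ a k, E' q = 0 := fun q hq => if_neg (by omega)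
    have hE'1 : ∀ q, a k < q → E' q = Z - x * y * ∑ p ∈ Finset.range q, E p :=
      fun q hq => if_pos hq
    have hZ'0 : a k = b k → Z' = Z := fun h => if_pos h
    have hZ'1 : a k < b k → Z' =
      (x + y) * E' (b k) - x * y * E (b k) + x * y * ∑ p ∈ Finset.range (b k), E' p :=
      fun h => if_neg h.ne
    refine ⟨E', Z', fun q hq => hE'0 q (hq.trans (ha k.le_succ)), fun q hq => ⟨?_, ?_⟩⟩
    · exact transfer_step (hab k) x y Z Z' E E' _ hE (fun q hq => (hH q hq).1) hE'0 hE'1 hZ'0 hZ'1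
        (hq.trans (hb k.le_succ))
    · exact transfer_step (hab k) y x Z Z' E E' _ hE (fun q hq => (hH q hq).2) hE'0
        (by simpa only [mul_comm y x] using hE'1) hZ'0
        (by simpa only [mul_comm y x, add_comm y x] using hZ'1) (hq.trans (hb k.le_succ))

theorem transferSum_comm {a b : ℕ → ℕ} (ha : Antitone a) (hb : Antitone b)
    (hab : ∀ j, a j ≤ b j) (x y : R) (k : ℕ) :
    transferSum a b x y k 0 = transferSum a b y x k 0 := by
  obtain ⟨E, Z, hE, hH⟩ := exists_transferSum_eq ha hb hab x y k
  rw [(hH 0 (Nat.zero_le _)).1, (hH 0 (Nat.zero_le _)).2, hE 0 (Nat.zero_le _)]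
  simp

open scoped Classical in
/-- The weakly decreasing sequences `p_0 ≥ ⋯ ≥ p_{k-1} ≥ q` with `a_j ≤ p_j ≤ b_j`, extended by
zeros. -/
noncomputable def boundedSeqs (a b : ℕ → ℕ) : ℕ → ℕ → Finset (ℕ → ℕ)
  | 0, _ => {0}
  | k + 1, q => (Finset.Icc (max q (a k)) (b k)).biUnion
      fun p => (boundedSeqs a b k p).image fun f => Function.update f k p

theorem mem_boundedSeqs {a b : ℕ → ℕ} {k q : ℕ} {f : ℕ → ℕ} :
    f ∈ boundedSeqs a b k q ↔ (∀ j < k, a j ≤ f j ∧ f j ≤ b j ∧ q ≤ f j) ∧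
      (∀ i j, i ≤ j → j < k → f j ≤ f i) ∧ ∀ j, k ≤ j → f j = 0 := by
  induction k generalizing q f with
  | zero => simp [boundedSeqs, funext_iff]
  | succ k ih =>
    simp only [boundedSeqs, Finset.mem_biUnion, Finset.mem_Icc, Finset.mem_image, ih]
    constructor
    · rintro ⟨p, ⟨hp1, hp2⟩, g, ⟨h1, h2, h3⟩, rfl⟩
      refine ⟨fun j hj => ?_, fun i j hij hj => ?_, fun j hj => ?_⟩
      · rcases (Nat.lt_succ_iff_lt_or_eq.1 hj) with h | rfl
        · rw [Function.update_of_ne h.ne]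
          have := h1 j h
          omega
        · rw [Function.update_self]
          omega
      · rcases (Nat.lt_succ_iff_lt_or_eq.1 hj) with h | rfl
        · rw [Function.update_of_ne h.ne, Function.update_of_ne (by omega)]
          exact h2 i j hij h
        · rcases hij.eq_or_lt with rfl | h
          · rfl
          · rw [Function.update_self, Function.update_of_ne h.ne]
            exact (h1 i h).2.2
      · rw [Function.update_of_ne (by omega)]
        exact h3 j (by omega)
    · rintro ⟨h1, h2, h3⟩
      have hk := h1 k (by omega)
      refine ⟨f k, ⟨by omega, hk.2.1⟩, Function.update f k 0, ⟨fun j hj => ?_, fun i j hij hj => ?_,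
        fun j hj => ?_⟩, by simp⟩
      · rw [Function.update_of_ne hj.ne]
        exact ⟨(h1 j (by omega)).1, (h1 j (by omega)).2.1, h2 j k hj.le (by omega)⟩
      · rw [Function.update_of_ne (by omega), Function.update_of_ne (by omega)]
        exact h2 i j hij (by omega)
      · rcases hj.eq_or_lt with rfl | h
        · simp
        · rw [Function.update_of_ne (by omega)]
          exact h3 j h

theorem transferSum_eq_sum (a b : ℕ → ℕ) (x y : R) (k q : ℕ) :
    transferSum a b x y k q = ∑ f ∈ boundedSeqs a b k q, ∏ j ∈ Finset.range k,
      ((if a j < f j then x else 1) * (if f j < b j then y else 1)) := by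
  classical
  induction k generalizing q with
  | zero => simp [transferSum, boundedSeqs]
  | succ k ih =>
    rw [transferSum, boundedSeqs, Finset.sum_biUnion]
    · refine Finset.sum_congr rfl fun p _ => ?_
      rw [Finset.sum_image, ih, Finset.mul_sum]
      · refine Finset.sum_congr rfl fun f _ => ?_
        rw [Finset.prod_range_succ, Function.update_self, mul_comm]
        congr 1
        refine Finset.prod_congr rfl fun j hj => ?_
        rw [Function.update_of_ne (Finset.mem_range.1 hj).ne]
      -- Both sequences are zero at index `k`, so the update there loses no information.
      · intro f hf g hg hfg
        have hf := (mem_boundedSeqs.1 hf).2.2 k le_rfl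
        have hg := (mem_boundedSeqs.1 hg).2.2 k le_rfl
        funext j
        by_cases h : j = k
        · rw [h, hf, hg]
        · simpa [Function.update_of_ne h] using congrFun hfg j
    · intro p _ p' _ hpp'
      rw [Function.onFun, Finset.disjoint_left]
      intro f hf hf'
      obtain ⟨g, _, rfl⟩ := Finset.mem_image.1 hf
      obtain ⟨g', _, h⟩ := Finset.mem_image.1 hf'
      exact hpp' (by simpa using (congrFun h k).symm)

/-- Compares the coefficients of `x ^ s * y ^ t` in `transferSum_comm` for two indeterminates. -/
theorem card_boundedSeqs_filter_swap {a b : ℕ → ℕ} (ha : Antitone a) (hb : Antitone b)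
    (hab : ∀ j, a j ≤ b j) (n s t : ℕ) :
    ((boundedSeqs a b n 0).filter fun f =>
      ((Finset.range n).filter fun j => a j < f j).card = s ∧
      ((Finset.range n).filter fun j => f j < b j).card = t).card =
    ((boundedSeqs a b n 0).filter fun f =>
      ((Finset.range n).filter fun j => a j < f j).card = t ∧
      ((Finset.range n).filter fun j => f j < b j).card = s).card := by
  -- The monoid algebra of `ℕ × ℕ` plays the role of `ℤ[x, y]`; leaving `e` and `e'` free covers
  -- both orders of the indeterminates.
  have key : ∀ e e' : ℕ × ℕ, ∀ u : ℕ × ℕ,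
      (transferSum a b (AddMonoidAlgebra.single e (1 : ℤ)) (AddMonoidAlgebra.single e' 1) n 0 :
        AddMonoidAlgebra ℤ (ℕ × ℕ)).coeff u = (((boundedSeqs a b n 0).filter fun f =>
          ((Finset.range n).filter fun j => a j < f j).card • e +
          ((Finset.range n).filter fun j => f j < b j).card • e' = u).card : ℤ) := by
    intro e e' u
    rw [transferSum_eq_sum, Finset.card_filter, Nat.cast_sum]
    simp only [Finset.prod_mul_distrib, Finset.prod_ite, Finset.prod_const, one_pow, mul_one,
      AddMonoidAlgebra.single_pow, AddMonoidAlgebra.single_mul_single]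
    rw [AddMonoidAlgebra.coeff_sum, Finsupp.finsetSum_apply]
    refine Finset.sum_congr rfl fun f _ => ?_
    rw [AddMonoidAlgebra.coeff_single, Finsupp.single_apply]
    push_cast
    rfl
  have h := congrArg (fun F : AddMonoidAlgebra ℤ (ℕ × ℕ) => F.coeff (s, t)) (transferSum_comm ha hb hab
    (AddMonoidAlgebra.single ((1, 0) : ℕ × ℕ) (1 : ℤ)) (AddMonoidAlgebra.single (0, 1) 1) n)
  simp only [key, Nat.cast_inj] at h
  simpa [Prod.ext_iff, and_comm] using h

end Transfer

/-! ### Young diagrams as sequences of column lengths. -/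

section ColumnLengths

theorem YoungDiagram.le_iff_colLen_le {α β : YoungDiagram} :
    α ≤ β ↔ ∀ j, α.colLen j ≤ β.colLen j := by
  constructor
  · intro h j
    by_contra! hlt
    exact absurd (YoungDiagram.mem_iff_lt_colLen.1 (h (YoungDiagram.mem_iff_lt_colLen.2 hlt)))
      (lt_irrefl _)
  · rintro h ⟨i, j⟩ hc
    exact YoungDiagram.mem_iff_lt_colLen.2 ((YoungDiagram.mem_iff_lt_colLen.1 hc).trans_le (h j))

theorem YoungDiagram.colLen_injective : Function.Injective YoungDiagram.colLen := fun _ _ h =>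
  le_antisymm (YoungDiagram.le_iff_colLen_le.2 fun j => (congrFun h j).le)
    (YoungDiagram.le_iff_colLen_le.2 fun j => (congrFun h j).ge)

theorem YoungDiagram.exists_colLen_eq {f : ℕ → ℕ} (hf : Antitone f) {n : ℕ}
    (h0 : ∀ j, n ≤ j → f j = 0) : ∃ ν : YoungDiagram, ν.colLen = f := by
  have hmem : ∀ i j, (i, j) ∈ (Finset.range (f 0) ×ˢ Finset.range n).filter
      (fun c => c.1 < f c.2) ↔ i < f j := by
    intro i j
    simp only [Finset.mem_filter, Finset.mem_product, Finset.mem_range, and_iff_right_iff_imp]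
    intro h
    refine ⟨h.trans_le (hf (Nat.zero_le j)), ?_⟩
    by_contra! hj
    rw [h0 j hj] at h
    omega
  refine ⟨⟨(Finset.range (f 0) ×ˢ Finset.range n).filter (fun c => c.1 < f c.2), ?_⟩, ?_⟩
  · rintro ⟨i, j⟩ ⟨i', j'⟩ hle hc
    rw [Finset.mem_coe, hmem] at hc ⊢
    exact (hle.1.trans_lt hc).trans_le (hf hle.2)
  · funext j
    refine eq_of_forall_lt_iff fun i => ?_
    rw [← YoungDiagram.mem_iff_lt_colLen]
    exact hmem i j

theorem YoungDiagram.exists_forall_colLen_eq_zero (β : YoungDiagram) :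
    ∃ n, ∀ j, n ≤ j → β.colLen j = 0 := by
  refine ⟨β.rowLen 0, fun j hj => ?_⟩
  by_contra h
  exact absurd (YoungDiagram.mem_iff_lt_rowLen.1
    (YoungDiagram.mem_iff_lt_colLen.2 (Nat.pos_of_ne_zero h))) (not_lt.2 hj)

theorem mem_skewCells {lam mu : YoungDiagram} {c : ℕ × ℕ} :
    c ∈ skewCells lam mu ↔ c ∈ lam ∧ c ∉ mu := by
  rw [skewCells, Finset.mem_sdiff, YoungDiagram.mem_cells, YoungDiagram.mem_cells]

theorem mem_image_snd_skewCells {lam mu : YoungDiagram} {j : ℕ} :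
    j ∈ (skewCells lam mu).image Prod.snd ↔ mu.colLen j < lam.colLen j := by
  simp only [Finset.mem_image, mem_skewCells, Prod.exists, YoungDiagram.mem_iff_lt_colLen]
  constructor
  · rintro ⟨i, _, h, rfl⟩
    omega
  · intro h
    exact ⟨mu.colLen j, j, ⟨h, lt_irrefl _⟩, rfl⟩

theorem numColumns_eq_card_filter {lam mu : YoungDiagram} {n : ℕ}
    (hn : ∀ j, n ≤ j → lam.colLen j = 0) :
    numColumns lam mu = ((Finset.range n).filter fun j => mu.colLen j < lam.colLen j).card := by
  rw [numColumns]
  congr 1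
  ext j
  rw [mem_image_snd_skewCells, Finset.mem_filter, Finset.mem_range, iff_and_self]
  intro h
  by_contra! hj
  rw [hn j hj] at h
  omega

/-- The Young diagrams `ν` between `α` and `β` for which `ν/α` has `s` columns and `β/ν` has `t`
columns. -/
def intermediateDiagrams (α β : YoungDiagram) (s t : ℕ) : Set YoungDiagram :=
  {ν | α ≤ ν ∧ ν ≤ β ∧ numColumns ν α = s ∧ numColumns β ν = t}

theorem colLen_image_intermediateDiagrams {α β : YoungDiagram} (hαβ : α ≤ β) {n : ℕ}
    (hn : ∀ j, n ≤ j → β.colLen j = 0) (s t : ℕ) :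
    YoungDiagram.colLen '' intermediateDiagrams α β s t =
      ((boundedSeqs α.colLen β.colLen n 0).filter fun f =>
        ((Finset.range n).filter fun j => α.colLen j < f j).card = s ∧
        ((Finset.range n).filter fun j => f j < β.colLen j).card = t : Finset (ℕ → ℕ)) := by
  ext f
  simp only [Set.mem_image, Finset.coe_filter, Set.mem_ofPred_eq, mem_boundedSeqs,
    intermediateDiagrams]
  constructor
  · rintro ⟨ν, ⟨h1, h2, h3, h4⟩, rfl⟩
    rw [YoungDiagram.le_iff_colLen_le] at h1 h2
    have hν : ∀ j, n ≤ j → ν.colLen j = 0 := fun j hj => by have := hn j hj; have := h2 j; omega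
    rw [numColumns_eq_card_filter hν] at h3
    rw [numColumns_eq_card_filter hn] at h4
    exact ⟨⟨fun j _ => ⟨h1 j, h2 j, Nat.zero_le _⟩, fun i j hij _ => ν.colLen_anti i j hij, hν⟩,
      h3, h4⟩
  · rintro ⟨⟨h1, h2, h3⟩, h4, h5⟩
    have hf : Antitone f := fun i j hij => by
      rcases lt_or_ge j n with h | h
      · exact h2 i j hij h
      · rw [h3 j h]; exact Nat.zero_le _
    obtain ⟨ν, rfl⟩ := YoungDiagram.exists_colLen_eq hf h3
    have hle : ν ≤ β := YoungDiagram.le_iff_colLen_le.2 fun j => by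
      rcases lt_or_ge j n with h | h
      · exact (h1 j h).2.1
      · rw [h3 j h]; exact Nat.zero_le _
    refine ⟨ν, ⟨?_, hle, ?_, ?_⟩, rfl⟩
    · refine YoungDiagram.le_iff_colLen_le.2 fun j => ?_
      rcases lt_or_ge j n with h | h
      · exact (h1 j h).1
      · rw [h3 j h, ← hn j h]
        exact YoungDiagram.le_iff_colLen_le.1 hαβ j
    · rw [numColumns_eq_card_filter h3, h4]
    · rw [numColumns_eq_card_filter hn, h5]

theorem ncard_intermediateDiagrams_swap {α β : YoungDiagram} (hαβ : α ≤ β) (s t : ℕ) :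
    (intermediateDiagrams α β s t).Finite ∧
    (intermediateDiagrams α β s t).ncard = (intermediateDiagrams α β t s).ncard := by
  obtain ⟨n, hn⟩ := β.exists_forall_colLen_eq_zero
  constructor
  · refine Set.Finite.of_finite_image ?_ YoungDiagram.colLen_injective.injOn
    rw [colLen_image_intermediateDiagrams hαβ hn]
    exact Finset.finite_toSet _
  · rw [← Set.ncard_image_of_injective _ YoungDiagram.colLen_injective,
      ← Set.ncard_image_of_injective (intermediateDiagrams α β t s) YoungDiagram.colLen_injective,
      colLen_image_intermediateDiagrams hαβ hn, colLen_image_intermediateDiagrams hαβ hn,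
      Set.ncard_coe_finset, Set.ncard_coe_finset]
    exact card_boundedSeqs_filter_swap (fun i j h => α.colLen_anti i j h)
      (fun i j h => β.colLen_anti i j h) (YoungDiagram.le_iff_colLen_le.1 hαβ) n s t

/-- No explicit bijection is needed: the equality of finite cardinalities provides the injection,
and if `α ≤ β` fails there is nothing to map. -/
theorem exists_injOn_intermediateDiagrams (α β : YoungDiagram) (s t : ℕ) :
    ∃ φ : YoungDiagram → YoungDiagram,
      Set.MapsTo φ (intermediateDiagrams α β s t) (intermediateDiagrams α β t s) ∧
      Set.InjOn φ (intermediateDiagrams α β s t) := by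
  by_cases hαβ : α ≤ β
  · obtain ⟨hfin, hcard⟩ := ncard_intermediateDiagrams_swap hαβ s t
    have hfin' := (ncard_intermediateDiagrams_swap hαβ t s).1
    obtain ⟨φ, h1, h2⟩ := hfin.exists_injOn_of_encard_le (t := intermediateDiagrams α β t s) (by
      rw [← hfin.cast_ncard_eq, ← hfin'.cast_ncard_eq, hcard])
    exact ⟨φ, fun x hx => h1 hx, h2⟩
  · have : intermediateDiagrams α β s t = ∅ :=
      Set.eq_empty_of_forall_notMem fun ν hν => hαβ (hν.1.trans hν.2.1)
    exact ⟨id, by simp [this, Set.MapsTo]⟩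

end ColumnLengths

/-! ### Reverse plane partitions as chains of diagrams, and symmetry. -/

section Chains

/-- `ν` is a chain `mu = ν_0 ≤ ν_1 ≤ ⋯` of Young diagrams that is eventually `lam` and for which
`ν_{k+1}/ν_k` has `m_k` columns. -/
structure IsGrowthChain (lam mu : YoungDiagram) (m : ℕ →₀ ℕ) (ν : ℕ → YoungDiagram) : Prop where
  zero : ν 0 = mu
  mono : Monotone ν
  eventually_eq : ∃ N, ∀ k, N ≤ k → ν k = lam
  numColumns_eq : ∀ k, numColumns (ν (k + 1)) (ν k) = m k

theorem IsGrowthChain.le {lam mu : YoungDiagram} {m : ℕ →₀ ℕ} {ν : ℕ → YoungDiagram}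
    (h : IsGrowthChain lam mu m ν) (k : ℕ) : ν k ≤ lam := by
  obtain ⟨N, hN⟩ := h.eventually_eq
  rw [← hN (max N k) (le_max_left _ _)]
  exact h.mono (le_max_right _ _)

/-- The filling that records at which step of the chain `ν` a box is added. -/
noncomputable def fillingOfChain (lam mu : YoungDiagram) (ν : ℕ → YoungDiagram)
    (a : skewCells lam mu) : ℕ :=
  sInf {k | a.1 ∈ ν (k + 1)}

theorem IsGrowthChain.fillingOfChain_lt_iff {lam mu : YoungDiagram} {m : ℕ →₀ ℕ}
    {ν : ℕ → YoungDiagram} (h : IsGrowthChain lam mu m ν) (a : skewCells lam mu) (k : ℕ) :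
    fillingOfChain lam mu ν a < k ↔ a.1 ∈ ν k := by
  have ha := mem_skewCells.1 a.2
  obtain ⟨N, hN⟩ := h.eventually_eq
  -- Rules out the default value 0 of `sInf` on the empty set.
  have hne : {k | a.1 ∈ ν (k + 1)}.Nonempty := ⟨N, by
    rw [Set.mem_ofPred_eq, hN (N + 1) (Nat.le_succ N)]; exact ha.1⟩
  constructor
  · intro hk
    exact h.mono hk (Nat.sInf_mem hne : a.1 ∈ ν (fillingOfChain lam mu ν a + 1))
  · intro hk
    cases k with
    | zero => rw [h.zero] at hk; exact absurd hk ha.2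
    | succ k => exact Nat.lt_succ_of_le (Nat.sInf_le hk)

theorem IsGrowthChain.isReversePlanePartition {lam mu : YoungDiagram} {m : ℕ →₀ ℕ}
    {ν : ℕ → YoungDiagram} (h : IsGrowthChain lam mu m ν) :
    IsReversePlanePartition (fillingOfChain lam mu ν) := by
  have key : ∀ a b : skewCells lam mu, a.1.1 ≤ b.1.1 → a.1.2 ≤ b.1.2 →
      fillingOfChain lam mu ν a ≤ fillingOfChain lam mu ν b := by
    intro a b h1 h2
    refine Nat.lt_succ_iff.1 ((h.fillingOfChain_lt_iff a _).2 ?_)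
    exact (ν _).up_left_mem h1 h2 ((h.fillingOfChain_lt_iff b _).1 (Nat.lt_succ_self _))
  exact ⟨fun a b h1 h2 => key a b h1.le h2, fun a b h1 h2 => key a b h2 h1.le⟩

theorem rppWeight_apply_eq_numColumns {lam mu : YoungDiagram} {T : skewCells lam mu → ℕ}
    {ν : ℕ → YoungDiagram} (h0 : ∀ k, mu ≤ ν k) (h1 : ∀ k, ν k ≤ lam)
    (hT : ∀ a k, T a < k ↔ a.1 ∈ ν k) (k : ℕ) :
    rppWeight T k = numColumns (ν (k + 1)) (ν k) := by
  rw [rppWeight, Finsupp.onFinset_apply, numColumns]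
  congr 1
  ext j
  simp only [Finset.mem_image, Finset.mem_filter, Finset.mem_univ, true_and,
    mem_skewCells]
  constructor
  · rintro ⟨a, rfl, rfl⟩
    exact ⟨a.1, ⟨(hT a _).1 (Nat.lt_succ_self _), fun hc => lt_irrefl _ ((hT a _).2 hc)⟩, rfl⟩
  · rintro ⟨c, ⟨hc1, hc2⟩, rfl⟩
    have hc : c ∈ skewCells lam mu := mem_skewCells.2 ⟨h1 _ hc1, fun hc => hc2 (h0 k hc)⟩
    refine ⟨⟨c, hc⟩, ?_, rfl⟩
    have h3 := (hT ⟨c, hc⟩ (k + 1)).2 hc1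
    have h4 := mt (hT ⟨c, hc⟩ k).1 hc2
    omega

theorem IsGrowthChain.rppWeight_eq {lam mu : YoungDiagram} {m : ℕ →₀ ℕ}
    {ν : ℕ → YoungDiagram} (h : IsGrowthChain lam mu m ν) :
    rppWeight (fillingOfChain lam mu ν) = m := by
  ext k
  rw [rppWeight_apply_eq_numColumns (fun k => h.zero.symm.le.trans (h.mono (Nat.zero_le k))) h.le
    h.fillingOfChain_lt_iff, h.numColumns_eq]

theorem IsReversePlanePartition.exists_isGrowthChain {lam mu : YoungDiagram} (hle : mu ≤ lam)
    {T : skewCells lam mu → ℕ} (hT : IsReversePlanePartition T) :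
    ∃ ν, IsGrowthChain lam mu (rppWeight T) ν ∧ fillingOfChain lam mu ν = T := by
  have hmono : ∀ a b : skewCells lam mu, a.1 ≤ b.1 → T a ≤ T b := by
    rintro ⟨⟨i, j⟩, ha⟩ ⟨⟨i', j'⟩, hb⟩ ⟨h1, h2⟩
    -- The corner `(i, j')` links the two boxes by a row step and a column step without leaving the
    -- skew shape.
    have hc : (i, j') ∈ skewCells lam mu :=
      mem_skewCells.2 ⟨lam.up_left_mem h1 le_rfl (mem_skewCells.1 hb).1,
        fun hc => (mem_skewCells.1 ha).2 (mu.up_left_mem le_rfl h2 hc)⟩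
    exact (hT.1 ⟨(i, j), ha⟩ ⟨(i, j'), hc⟩ rfl h2).trans
      (hT.2 ⟨(i, j'), hc⟩ ⟨(i', j'), hb⟩ rfl h1)
  let ν : ℕ → YoungDiagram := fun k =>
    ⟨mu.cells ∪ (Finset.univ.filter fun a => T a < k).image Subtype.val, by
      intro c d hdc hc
      rw [Finset.mem_coe, Finset.mem_union] at hc ⊢
      rcases hc with hc | hc
      · exact Or.inl (mu.isLowerSet hdc hc)
      · obtain ⟨a, ha, rfl⟩ := Finset.mem_image.1 hc
        by_cases hd : d ∈ mu.cells
        · exact Or.inl hd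
        · have hd' : d ∈ skewCells lam mu :=
            mem_skewCells.2 ⟨lam.isLowerSet hdc (mem_skewCells.1 a.2).1, hd⟩
          refine Or.inr (Finset.mem_image.2 ⟨⟨d, hd'⟩, Finset.mem_filter.2 ⟨Finset.mem_univ _, ?_⟩,
            rfl⟩)
          exact (hmono ⟨d, hd'⟩ a hdc).trans_lt (Finset.mem_filter.1 ha).2⟩
  have hν : ∀ k c, c ∈ ν k ↔ c ∈ mu ∨ ∃ a, T a < k ∧ a.1 = c := by
    intro k c
    rw [← YoungDiagram.mem_cells]
    simp only [ν, Finset.mem_union, YoungDiagram.mem_cells, Finset.mem_image,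
      Finset.mem_filter, Finset.mem_univ, true_and]
  have hTν : ∀ a k, T a < k ↔ a.1 ∈ ν k := by
    intro a k
    rw [hν]
    constructor
    · exact fun h => Or.inr ⟨a, h, rfl⟩
    · rintro (h | ⟨b, hb, hba⟩)
      · exact absurd h (mem_skewCells.1 a.2).2
      · rwa [← Subtype.ext hba]
  have h0 : ∀ k, mu ≤ ν k := fun k c hc => (hν k c).2 (Or.inl hc)
  have h1 : ∀ k, ν k ≤ lam := by
    intro k c hc
    rcases (hν k c).1 hc with h | ⟨a, _, rfl⟩
    · exact hle h
    · exact (mem_skewCells.1 a.2).1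
  have hchain : IsGrowthChain lam mu (rppWeight T) ν := by
    -- One past the largest letter, every box has been added.
    refine ⟨?_, ?_, ⟨Finset.univ.sup T + 1, fun k hk => le_antisymm (h1 k) fun c hc => ?_⟩,
      fun k => (rppWeight_apply_eq_numColumns h0 h1 hTν k).symm⟩
    · refine le_antisymm (fun c hc => ?_) (h0 0)
      rcases (hν 0 c).1 hc with h | ⟨a, h, _⟩
      · exact h
      · exact absurd h (Nat.not_lt_zero _)
    · intro k l hkl c hc
      rcases (hν k c).1 hc with h | ⟨a, h, h'⟩
      · exact (hν l c).2 (Or.inl h)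
      · exact (hν l c).2 (Or.inr ⟨a, h.trans_le hkl, h'⟩)
    · by_cases hcm : c ∈ mu
      · exact h0 k hcm
      · refine (hTν ⟨c, mem_skewCells.2 ⟨hc, hcm⟩⟩ k).1 ?_
        exact (Nat.lt_succ_of_le (Finset.le_sup (Finset.mem_univ _))).trans_le hk
  refine ⟨ν, hchain, funext fun a => eq_of_forall_gt_iff fun k => ?_⟩
  rw [hchain.fillingOfChain_lt_iff, hTν]

/-- The inverse sends `T` to the diagrams formed by `mu` and the boxes with `T < k`. The boxes
carrying the letter `k` are then those of `ν (k + 1)` outside `ν k`, which matches the weights. -/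
theorem bijOn_fillingOfChain {lam mu : YoungDiagram} (hle : mu ≤ lam) (m : ℕ →₀ ℕ) :
    Set.BijOn (fillingOfChain lam mu) {ν | IsGrowthChain lam mu m ν}
      {T | IsReversePlanePartition T ∧ rppWeight T = m} := by
  refine ⟨fun ν hν => ⟨hν.isReversePlanePartition, hν.rppWeight_eq⟩, ?_, ?_⟩
  · have key : ∀ ν ν', IsGrowthChain lam mu m ν → IsGrowthChain lam mu m ν' →
        fillingOfChain lam mu ν = fillingOfChain lam mu ν' → ∀ k, ν k ≤ ν' k := by
      intro ν ν' hν hν' h k c hc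
      by_cases hcm : c ∈ mu
      · rw [← hν'.zero] at hcm
        exact hν'.mono (Nat.zero_le k) hcm
      · have hc' : c ∈ skewCells lam mu := mem_skewCells.2 ⟨hν.le k hc, hcm⟩
        have := (hν.fillingOfChain_lt_iff ⟨c, hc'⟩ k).2 hc
        rw [h] at this
        exact (hν'.fillingOfChain_lt_iff ⟨c, hc'⟩ k).1 this
    exact fun ν hν ν' hν' h => funext fun k =>
      le_antisymm (key ν ν' hν hν' h k) (key ν' ν hν' hν h.symm k)
  · rintro T ⟨hT, rfl⟩
    exact hT.exists_isGrowthChain hle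

theorem finite_isGrowthChain {lam mu : YoungDiagram} (hle : mu ≤ lam) (m : ℕ →₀ ℕ) :
    {ν | IsGrowthChain lam mu m ν}.Finite :=
  (bijOn_fillingOfChain hle m).finite_iff_finite.2 (finite_rppWeight_eq lam mu m)

theorem coeff_dualGrothendieck (K : Type*) [CommRing K] {lam mu : YoungDiagram} (hle : mu ≤ lam)
    (m : ℕ →₀ ℕ) : MvPowerSeries.coeff m (dualGrothendieck K lam mu) =
      ({ν | IsGrowthChain lam mu m ν}.ncard : K) := by
  have h := bijOn_fillingOfChain hle m
  change (({T : skewCells lam mu → ℕ | IsReversePlanePartition T ∧ rppWeight T = m}.ncard : ℕ) : K)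
    = _
  rw [← h.image_eq, h.injOn.ncard_image]

/-- Only `ν (i + 1)` is replaced, by a diagram between the same neighbours with the two column
counts exchanged. Since the neighbours stay visible, injectivity of `φ` for these neighbours
recovers the chain. -/
theorem ncard_isGrowthChain_swap_le {lam mu : YoungDiagram} (hle : mu ≤ lam) (m : ℕ →₀ ℕ) (i : ℕ) :
    {ν | IsGrowthChain lam mu m ν}.ncard ≤
      {ν | IsGrowthChain lam mu (m.equivMapDomain (Equiv.swap i (i + 1))) ν}.ncard := by
  choose φ hφ hinj using fun α β => exists_injOn_intermediateDiagrams α β (m i) (m (i + 1))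
  have hmem : ∀ ν, IsGrowthChain lam mu m ν →
      ν (i + 1) ∈ intermediateDiagrams (ν i) (ν (i + 2)) (m i) (m (i + 1)) := fun ν hν =>
    ⟨hν.mono (by omega), hν.mono (by omega), hν.numColumns_eq i, hν.numColumns_eq (i + 1)⟩
  refine Set.ncard_le_ncard_of_injOn
    (fun ν => Function.update ν (i + 1) (φ (ν i) (ν (i + 2)) (ν (i + 1)))) ?_ ?_
    (finite_isGrowthChain hle _)
  · intro ν hν
    obtain ⟨h1, h2, h3, h4⟩ := hφ _ _ (hmem ν hν)
    generalize φ (ν i) (ν (i + 2)) (ν (i + 1)) = ρ at h1 h2 h3 h4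
    obtain ⟨N, hN⟩ := hν.eventually_eq
    refine ⟨?_, monotone_nat_of_le_succ fun k => ?_, ⟨max N (i + 2), fun k hk => ?_⟩, fun k => ?_⟩
    · rw [Function.update_of_ne (by omega), hν.zero]
    · rcases eq_or_ne k i with rfl | hki
      · rwa [Function.update_self, Function.update_of_ne (by omega)]
      · rcases eq_or_ne k (i + 1) with rfl | hki'
        · rwa [Function.update_self, Function.update_of_ne (by omega)]
        · rw [Function.update_of_ne hki', Function.update_of_ne (by omega)]
          exact hν.mono k.le_succ
    · rw [Function.update_of_ne (by omega)]
      exact hN k (by omega)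
    · rw [Finsupp.equivMapDomain_apply, Equiv.symm_swap]
      rcases eq_or_ne k i with rfl | hki
      · rw [Function.update_self, Function.update_of_ne (by omega), Equiv.swap_apply_left, h3]
      · rcases eq_or_ne k (i + 1) with rfl | hki'
        · rw [Function.update_self, Function.update_of_ne (by omega), Equiv.swap_apply_right, h4]
        · rw [Function.update_of_ne hki', Function.update_of_ne (by omega),
            Equiv.swap_apply_of_ne_of_ne hki hki', hν.numColumns_eq]
  · intro ν hν ν' hν' h
    have hne : ∀ k, k ≠ i + 1 → ν k = ν' k := fun k hk => by
      simpa [Function.update_of_ne hk] using congrFun h k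
    have hi := congrFun h (i + 1)
    simp only [Function.update_self] at hi
    rw [← hne i (by omega), ← hne (i + 2) (by omega)] at hi
    have h' := hmem ν' hν'
    rw [← hne i (by omega), ← hne (i + 2) (by omega)] at h'
    funext k
    by_cases hk : k = i + 1
    · rw [hk]
      exact hinj _ _ (hmem ν hν) h' hi
    · exact hne k hk

theorem coeff_dualGrothendieck_swap (K : Type*) [CommRing K] {lam mu : YoungDiagram}
    (hle : mu ≤ lam) (m : ℕ →₀ ℕ) (i : ℕ) :
    MvPowerSeries.coeff (m.equivMapDomain (Equiv.swap i (i + 1))) (dualGrothendieck K lam mu) =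
      MvPowerSeries.coeff m (dualGrothendieck K lam mu) := by
  rw [coeff_dualGrothendieck K hle, coeff_dualGrothendieck K hle]
  congr 1
  refine le_antisymm ?_ (ncard_isGrowthChain_swap_le hle m i)
  -- The swap is an involution, so the inequality at the swapped exponent is the reverse one.
  have h := ncard_isGrowthChain_swap_le hle (m.equivMapDomain (Equiv.swap i (i + 1))) i
  have hswap := Equiv.self_trans_symm (Equiv.swap i (i + 1))
  rw [Equiv.symm_swap] at hswap
  rwa [← Finsupp.equivMapDomain_trans, hswap, Finsupp.equivMapDomain_refl] at h

end Chains

/-! ### Lexicographic leading terms and linear independence. -/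

section LeadingTerm

/-- The row lengths of a Young diagram, as an exponent. -/
noncomputable def rowExponent (lam : YoungDiagram) : ℕ →₀ ℕ :=
  Finsupp.onFinset (Finset.range (lam.colLen 0)) lam.rowLen fun i hi => by
    rw [Finset.mem_range, ← YoungDiagram.mem_iff_lt_colLen, YoungDiagram.mem_iff_lt_rowLen]
    exact Nat.pos_of_ne_zero hi

@[simp]
theorem rowExponent_apply (lam : YoungDiagram) (i : ℕ) : rowExponent lam i = lam.rowLen i := rfl

theorem lt_rowLen_iff_lt_colLen {lam : YoungDiagram} {i j : ℕ} :
    j < lam.rowLen i ↔ i < lam.colLen j := by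
  rw [← YoungDiagram.mem_iff_lt_rowLen, YoungDiagram.mem_iff_lt_colLen]

theorem rowExponent_injective : Function.Injective rowExponent := fun α β h => by
  refine YoungDiagram.colLen_injective (funext fun j => eq_of_forall_lt_iff fun i => ?_)
  rw [← lt_rowLen_iff_lt_colLen, ← lt_rowLen_iff_lt_colLen, ← rowExponent_apply, h,
    rowExponent_apply]

theorem exists_rowExponent_eq {m : ℕ →₀ ℕ} (hm : ∀ i, m (i + 1) ≤ m i) :
    ∃ lam, rowExponent lam = m := by
  obtain ⟨ν, hν⟩ := YoungDiagram.exists_colLen_eq (f := m) (antitone_nat_of_succ_le hm)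
    (n := m.support.sup id + 1) fun j hj => by
      by_contra h
      have := Finset.le_sup (f := id) (Finsupp.mem_support_iff.2 h)
      simp only [id] at this
      omega
  refine ⟨ν.transpose, Finsupp.ext fun i => ?_⟩
  rw [rowExponent_apply, YoungDiagram.rowLen_transpose, hν]

theorem degree_rowExponent (lam : YoungDiagram) : (rowExponent lam).degree = lam.card := by
  rw [Finsupp.degree_apply, Finset.sum_subset
    (show (rowExponent lam).support ⊆ Finset.range (lam.colLen 0) from
      Finsupp.support_onFinset_subset)
    fun i _ hi => Finsupp.notMem_support_iff.1 hi]
  rw [YoungDiagram.card, Finset.card_eq_sum_card_fiberwise (f := Prod.fst)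
    (t := Finset.range (lam.colLen 0))]
  · refine Finset.sum_congr rfl fun i _ => ?_
    rw [rowExponent_apply, YoungDiagram.rowLen_eq_card]
    rfl
  · rintro ⟨i, j⟩ hc
    rw [Finset.mem_coe, YoungDiagram.mem_cells] at hc
    exact Finset.mem_coe.2 (Finset.mem_range.2
      (YoungDiagram.mem_iff_lt_colLen.1 (lam.up_left_mem le_rfl (Nat.zero_le j) hc)))

/-- A letter meets at most as many columns as it fills boxes. -/
theorem degree_rppWeight_le {lam mu : YoungDiagram} (T : skewCells lam mu → ℕ) :
    (rppWeight T).degree ≤ lam.card := by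
  rw [Finsupp.degree_apply, Finset.sum_subset
    (show (rppWeight T).support ⊆ Finset.univ.image T from Finsupp.support_onFinset_subset)
    fun i _ hi => Finsupp.notMem_support_iff.1 hi]
  calc ∑ k ∈ Finset.univ.image T, rppWeight T k
      ≤ ∑ k ∈ Finset.univ.image T, (Finset.univ.filter fun a => T a = k).card :=
        Finset.sum_le_sum fun k _ => Finset.card_image_le
    _ = (Finset.univ : Finset (skewCells lam mu)).card :=
        (Finset.card_eq_sum_card_image T _).symm
    _ = (skewCells lam mu).card := by rw [Finset.card_univ, Fintype.card_coe]
    _ ≤ lam.card := Finset.card_le_card Finset.sdiff_subset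

theorem finite_setOf_card_le (D : ℕ) : {lam : YoungDiagram | lam.card ≤ D}.Finite := by
  refine Set.Finite.of_finite_image (f := YoungDiagram.cells) ?_ ?_
  · refine (Finset.finite_toSet (Finset.range D ×ˢ Finset.range D).powerset).subset ?_
    rintro _ ⟨lam, hlam, rfl⟩
    rw [Finset.mem_coe, Finset.mem_powerset]
    rintro ⟨i, j⟩ hc
    rw [YoungDiagram.mem_cells] at hc
    rw [Finset.mem_product, Finset.mem_range, Finset.mem_range]
    have h1 := YoungDiagram.mem_iff_lt_colLen.1 hc
    have h2 := YoungDiagram.mem_iff_lt_rowLen.1 hc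
    rw [YoungDiagram.colLen_eq_card] at h1
    rw [YoungDiagram.rowLen_eq_card] at h2
    exact ⟨(h1.trans_le (Finset.card_filter_le _ _)).trans_le hlam,
      (h2.trans_le (Finset.card_filter_le _ _)).trans_le hlam⟩
  · exact fun α _ β _ h => YoungDiagram.ext h

theorem numColumns_eq_rowLen {α β lam : YoungDiagram} {k : ℕ}
    (h : ∀ c, α.colLen c < β.colLen c ↔ k < lam.colLen c) : numColumns β α = lam.rowLen k := by
  rw [numColumns, ← Finset.card_range (lam.rowLen k)]
  congr 1
  ext c
  rw [mem_image_snd_skewCells, h, Finset.mem_range, lt_rowLen_iff_lt_colLen]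

/-- By `hk`, a column of `lam` of height at most `k` is already full in `ν k`, so only the taller
ones can still grow. -/
theorem IsGrowthChain.image_skewCells_subset {lam : YoungDiagram} {m : ℕ →₀ ℕ}
    {ν : ℕ → YoungDiagram} (h : IsGrowthChain lam ⊥ m ν) {k : ℕ}
    (hk : ∀ c, min k (lam.colLen c) ≤ (ν k).colLen c) :
    (skewCells (ν (k + 1)) (ν k)).image Prod.snd ⊆ Finset.range (lam.rowLen k) := by
  intro c hc
  rw [mem_image_snd_skewCells] at hc
  rw [Finset.mem_range, lt_rowLen_iff_lt_colLen]
  have h1 := hk c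
  have h2 := YoungDiagram.le_iff_colLen_le.1 (h.le (k + 1)) c
  omega

/-- A step that adds to the maximal possible number of columns adds to every column that is allowed
to grow. -/
theorem IsGrowthChain.min_le_colLen {lam : YoungDiagram} {m : ℕ →₀ ℕ}
    {ν : ℕ → YoungDiagram} (h : IsGrowthChain lam ⊥ m ν) {k : ℕ}
    (hk : ∀ j < k, m j = lam.rowLen j) (c : ℕ) : min k (lam.colLen c) ≤ (ν k).colLen c := by
  induction k generalizing c with
  | zero => simp
  | succ k ih =>
    have ih := ih fun j hj => hk j (by omega)
    have heq := Finset.eq_of_subset_of_card_le (h.image_skewCells_subset ih) (by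
      rw [Finset.card_range, ← hk k (by omega), ← h.numColumns_eq k, numColumns])
    have hc : (ν k).colLen c < (ν (k + 1)).colLen c ↔ k < lam.colLen c := by
      rw [← mem_image_snd_skewCells, heq, Finset.mem_range, lt_rowLen_iff_lt_colLen]
    have h1 := ih c
    have h2 := YoungDiagram.le_iff_colLen_le.1 (h.mono (Nat.le_add_right k 1)) c
    omega

/-- Up to the first index `k` of disagreement the chain is maximal at each step; then at most
`lam.rowLen k` columns can grow at step `k`, so `m k` cannot be the larger entry. -/
theorem IsGrowthChain.toLex_le {lam : YoungDiagram} {m : ℕ →₀ ℕ} {ν : ℕ → YoungDiagram}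
    (h : IsGrowthChain lam ⊥ m ν) : toLex m ≤ toLex (rowExponent lam) := by
  by_contra! hlt
  obtain ⟨k, hk, hlt⟩ := Finsupp.Lex.lt_iff.1 hlt
  have h1 := Finset.card_le_card
    (h.image_skewCells_subset (h.min_le_colLen fun j hj => (hk j hj).symm))
  rw [Finset.card_range] at h1
  have h2 := h.numColumns_eq k
  rw [numColumns] at h2
  rw [h2] at h1
  exact absurd hlt (not_lt.2 h1)

theorem bot_colLen (j : ℕ) : (⊥ : YoungDiagram).colLen j = 0 := by
  by_contra h
  exact YoungDiagram.notMem_bot _ (YoungDiagram.mem_iff_lt_colLen.2 (Nat.pos_of_ne_zero h))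

/-- Column `c` grows at each of the first `lam.colLen c` steps and never exceeds `lam.colLen c`,
which leaves room for exactly one box per step. -/
theorem IsGrowthChain.colLen_eq_min {lam : YoungDiagram} {ν : ℕ → YoungDiagram}
    (h : IsGrowthChain lam ⊥ (rowExponent lam) ν) (k c : ℕ) :
    (ν k).colLen c = min k (lam.colLen c) := by
  have hle := fun k => h.min_le_colLen (k := k) fun j _ => rfl
  have hle' : ∀ k, (ν k).colLen c ≤ lam.colLen c := fun k =>
    YoungDiagram.le_iff_colLen_le.1 (h.le k) c
  have hstep : ∀ k, k < lam.colLen c → (ν k).colLen c < (ν (k + 1)).colLen c := by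
    intro k hk
    have heq := Finset.eq_of_subset_of_card_le (h.image_skewCells_subset (hle k)) (by
      rw [Finset.card_range, ← rowExponent_apply, ← h.numColumns_eq k, numColumns])
    rwa [← mem_image_snd_skewCells, heq, Finset.mem_range, lt_rowLen_iff_lt_colLen]
  have hadd : ∀ d, k + d ≤ lam.colLen c → (ν k).colLen c + d ≤ (ν (k + d)).colLen c := by
    intro d
    induction d with
    | zero => intro _; exact le_rfl
    | succ d ih =>
      intro hd
      have h1 := ih (by omega)
      have h2 := hstep (k + d) (by omega)
      change _ ≤ (ν (k + d + 1)).colLen c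
      omega
  have h1 := hle k c
  have h2 := hle' k
  rcases le_or_gt k (lam.colLen c) with hk | hk
  · have h3 := hadd (lam.colLen c - k) (by omega)
    have h4 := hle' (k + (lam.colLen c - k))
    omega
  · omega

theorem ncard_isGrowthChain_rowExponent (lam : YoungDiagram) :
    {ν | IsGrowthChain lam ⊥ (rowExponent lam) ν}.ncard = 1 := by
  rw [Set.ncard_eq_one]
  obtain ⟨n, hn⟩ := lam.exists_forall_colLen_eq_zero
  choose ν hν using fun k => YoungDiagram.exists_colLen_eq (f := fun c => min k (lam.colLen c))
    (fun i j hij => min_le_min_left _ (lam.colLen_anti i j hij)) (n := n)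
    fun j hj => by rw [hn j hj, Nat.min_zero]
  refine ⟨ν, Set.eq_singleton_iff_unique_mem.2 ⟨⟨?_, ?_, ⟨lam.colLen 0, fun k hk => ?_⟩, fun k => ?_⟩,
    fun ν' hν' => ?_⟩⟩
  · refine YoungDiagram.colLen_injective ?_
    rw [hν]
    funext c
    rw [bot_colLen, Nat.zero_min]
  · refine fun k l hkl => YoungDiagram.le_iff_colLen_le.2 fun c => ?_
    rw [hν, hν]
    exact min_le_min_right _ hkl
  · refine YoungDiagram.colLen_injective ?_
    rw [hν]
    exact funext fun c => min_eq_right ((lam.colLen_anti 0 c (Nat.zero_le c)).trans hk)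
  · refine numColumns_eq_rowLen fun c => ?_
    simp only [hν]
    omega
  · refine funext fun k => YoungDiagram.colLen_injective ?_
    rw [hν]
    exact funext fun c => IsGrowthChain.colLen_eq_min hν' k c

variable (K : Type*) [CommRing K]

theorem coeff_rowExponent_dualGrothendieck (lam : YoungDiagram) :
    MvPowerSeries.coeff (rowExponent lam) (dualGrothendieck K lam ⊥) = 1 := by
  rw [coeff_dualGrothendieck K bot_le, ncard_isGrowthChain_rowExponent, Nat.cast_one]

theorem toLex_le_of_coeff_dualGrothendieck_ne_zero {lam : YoungDiagram} {m : ℕ →₀ ℕ}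
    (h : MvPowerSeries.coeff m (dualGrothendieck K lam ⊥) ≠ 0) :
    toLex m ≤ toLex (rowExponent lam) := by
  rw [coeff_dualGrothendieck K bot_le] at h
  obtain ⟨ν, hν⟩ := Set.nonempty_of_ncard_ne_zero fun h0 => h (by rw [h0, Nat.cast_zero])
  exact IsGrowthChain.toLex_le hν

theorem degree_le_of_coeff_dualGrothendieck_ne_zero {lam mu : YoungDiagram} {m : ℕ →₀ ℕ}
    (h : MvPowerSeries.coeff m (dualGrothendieck K lam mu) ≠ 0) : m.degree ≤ lam.card := by
  obtain ⟨T, _, rfl⟩ := Set.nonempty_of_ncard_ne_zero fun h0 => h (by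
    change (({T : skewCells lam mu → ℕ | IsReversePlanePartition T ∧ rppWeight T = m}.ncard : ℕ)
      : K) = 0
    rw [h0, Nat.cast_zero])
  exact degree_rppWeight_le T

/-- At the largest leading exponent in the support, no other term contributes; the leading
coefficient is 1, so `K` may be any commutative ring. -/
theorem linearIndependent_dualGrothendieck :
    LinearIndependent K fun lam : YoungDiagram => dualGrothendieck K lam ⊥ := by
  rw [linearIndependent_iff]
  intro a ha
  by_contra hne
  obtain ⟨lam, hlam, hmax⟩ := a.support.exists_max_image (fun lam => toLex (rowExponent lam))
    (Finsupp.support_nonempty_iff.2 hne)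
  refine Finsupp.mem_support_iff.1 hlam ?_
  have h := congrArg (MvPowerSeries.coeff (rowExponent lam)) ha
  rw [Finsupp.linearCombination_apply, Finsupp.sum, map_sum, map_zero,
    Finset.sum_eq_single lam] at h
  · rwa [map_smul, coeff_rowExponent_dualGrothendieck, smul_eq_mul, mul_one] at h
  · intro kap hkap hne'
    rw [map_smul]
    by_contra h0
    have h1 := toLex_le_of_coeff_dualGrothendieck_ne_zero K (right_ne_zero_of_mul h0)
    exact hne' (rowExponent_injective (toLex.injective (le_antisymm (hmax kap hkap) h1)))
  · exact fun h => absurd hlam h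

end LeadingTerm

/-! ### Expanding symmetric series of bounded degree. -/

section Expansion

variable {K : Type*} [CommRing K]

/-- A power series is symmetric if its coefficients are invariant under exchanging the exponents of
two adjacent variables. -/
def IsSymmetricSeries (f : MvPowerSeries ℕ K) : Prop :=
  ∀ i m, MvPowerSeries.coeff (m.equivMapDomain (Equiv.swap i (i + 1))) f = MvPowerSeries.coeff m f

theorem IsSymmetricSeries.sub {f g : MvPowerSeries ℕ K} (hf : IsSymmetricSeries f)
    (hg : IsSymmetricSeries g) : IsSymmetricSeries (f - g) := fun i m => by
  rw [map_sub, map_sub, hf, hg]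

theorem IsSymmetricSeries.smul {f : MvPowerSeries ℕ K} (hf : IsSymmetricSeries f) (r : K) :
    IsSymmetricSeries (r • f) := fun i m => by
  rw [map_smul, map_smul, hf]

theorem IsSymmetricSeries.mul {f g : MvPowerSeries ℕ K} (hf : IsSymmetricSeries f)
    (hg : IsSymmetricSeries g) : IsSymmetricSeries (f * g) := fun i m => by
  classical
  rw [MvPowerSeries.coeff_mul, MvPowerSeries.coeff_mul]
  let e : (ℕ →₀ ℕ) ≃+ (ℕ →₀ ℕ) := Finsupp.domCongr (Equiv.swap i (i + 1))
  refine (Finset.sum_equiv (e.toEquiv.prodCongr e.toEquiv) (fun p => ?_) fun p _ => ?_).symm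
  · rw [Finset.HasAntidiagonal.mem_antidiagonal, Finset.HasAntidiagonal.mem_antidiagonal]
    change _ ↔ e p.1 + e p.2 = e m
    rw [← map_add, e.injective.eq_iff]
  · exact congrArg₂ _ (hf i p.1).symm (hg i p.2).symm

theorem isSymmetricSeries_dualGrothendieck {lam mu : YoungDiagram} (hle : mu ≤ lam) :
    IsSymmetricSeries (dualGrothendieck K lam mu) := fun i m =>
  coeff_dualGrothendieck_swap K hle m i

theorem equivMapDomain_swap_add (m : ℕ →₀ ℕ) (i : ℕ) :
    m.equivMapDomain (Equiv.swap i (i + 1)) +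
      (Finsupp.single i (m i) + Finsupp.single (i + 1) (m (i + 1))) =
    m + (Finsupp.single i (m (i + 1)) + Finsupp.single (i + 1) (m i)) := by
  ext j
  simp only [Finsupp.add_apply, Finsupp.equivMapDomain_apply, Equiv.symm_swap]
  rcases eq_or_ne j i with rfl | hi
  · simp [add_comm]
  · rcases eq_or_ne j (i + 1) with rfl | hi'
    · simp [add_comm]
    · simp [Equiv.swap_apply_of_ne_of_ne hi hi', hi.symm, hi'.symm]

/-- Sort the exponent into decreasing order by adjacent swaps. -/
theorem IsSymmetricSeries.exists_coeff_eq_coeff_rowExponent {f : MvPowerSeries ℕ K}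
    (hf : IsSymmetricSeries f) (m : ℕ →₀ ℕ) :
    ∃ lam, (rowExponent lam).degree = m.degree ∧
      MvPowerSeries.coeff m f = MvPowerSeries.coeff (rowExponent lam) f := by
  -- `W m` is the sum of `j * m j`; swapping an ascent at `i` lowers it by `m (i + 1) - m i`.
  let W : (ℕ →₀ ℕ) →+ ℕ := Finsupp.liftAddHom fun j => AddMonoidHom.mulLeft j
  have hW : ∀ j n, W (Finsupp.single j n) = j * n := fun j n => by simp [W]
  induction hn : W m using Nat.strong_induction_on generalizing m with
  | _ n ih =>
    by_cases hm : ∀ i, m (i + 1) ≤ m i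
    · obtain ⟨lam, rfl⟩ := exists_rowExponent_eq hm
      exact ⟨lam, rfl, rfl⟩
    · push Not at hm
      obtain ⟨i, hi⟩ := hm
      have key := equivMapDomain_swap_add m i
      have h1 := congrArg W key
      have h2 := congrArg Finsupp.degree key
      simp only [map_add, hW, Finsupp.degree_single] at h1 h2
      obtain ⟨lam, h3, h4⟩ := ih (W (m.equivMapDomain (Equiv.swap i (i + 1))))
        (by rw [add_mul, add_mul] at h1; omega) _ rfl
      exact ⟨lam, by omega, by rw [← h4, hf]⟩

theorem isExpansion_iff {f : MvPowerSeries ℕ K} {a : YoungDiagram →₀ K} :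
    IsExpansion f a ↔
      f = Finsupp.linearCombination K (fun lam => dualGrothendieck K lam ⊥) a := Iff.rfl

/-- Repeatedly cancel the largest coefficient at a partition exponent. The degree bound, which
subtraction preserves, confines the search to the finite set `S`. -/
theorem IsSymmetricSeries.exists_isExpansion {f : MvPowerSeries ℕ K} (hf : IsSymmetricSeries f)
    {D : ℕ} (hD : ∀ m, MvPowerSeries.coeff m f ≠ 0 → m.degree ≤ D) : ∃ a, IsExpansion f a := by
  classical
  let S : Finset YoungDiagram := (finite_setOf_card_le D).toFinset
  have hS : ∀ lam, lam ∈ S ↔ lam.card ≤ D := fun lam => by simp [S]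
  -- The measure counts all diagrams of `S` up to the leading one, not just the nonzero
  -- coefficients: subtraction can create new nonzero coefficients at lower exponents.
  let U : MvPowerSeries ℕ K → Finset YoungDiagram := fun f => S.filter fun kap => ∃ lam ∈ S,
    MvPowerSeries.coeff (rowExponent lam) f ≠ 0 ∧ toLex (rowExponent kap) ≤ toLex (rowExponent lam)
  induction hn : (U f).card using Nat.strong_induction_on generalizing f with
  | _ n ih =>
    by_cases hne : (S.filter fun lam => MvPowerSeries.coeff (rowExponent lam) f ≠ 0).Nonempty
    · obtain ⟨lam, hlam, hmax⟩ := Finset.exists_max_image _ (fun lam => toLex (rowExponent lam)) hne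
      rw [Finset.mem_filter] at hlam
      let r := MvPowerSeries.coeff (rowExponent lam) f
      have hg := isSymmetricSeries_dualGrothendieck (K := K) (bot_le : ⊥ ≤ lam)
      have hcoeff : ∀ kap ∈ S, MvPowerSeries.coeff (rowExponent kap)
          (f - r • dualGrothendieck K lam ⊥) ≠ 0 →
          toLex (rowExponent kap) < toLex (rowExponent lam) := by
        intro kap hkap h
        rw [map_sub, map_smul, smul_eq_mul] at h
        refine lt_of_le_of_ne ?_ ?_
        · by_contra hlt
          refine h ?_
          rw [not_imp_comm.1 (toLex_le_of_coeff_dualGrothendieck_ne_zero K) hlt, mul_zero,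
            sub_zero]
          by_contra h0
          exact hlt (hmax kap (Finset.mem_filter.2 ⟨hkap, h0⟩))
        · intro heq
          obtain rfl := rowExponent_injective (toLex.injective heq)
          exact h (by rw [coeff_rowExponent_dualGrothendieck, mul_one, sub_self])
      have hcard : (U (f - r • dualGrothendieck K lam ⊥)).card < n := by
        rw [← hn]
        refine Finset.card_lt_card (Finset.ssubset_iff_of_subset ?_ |>.2 ⟨lam, ?_, ?_⟩)
        · intro kap hkap
          obtain ⟨hkap, rho, hrho, h0, hle⟩ := Finset.mem_filter.1 hkap
          exact Finset.mem_filter.2 ⟨hkap, lam, hlam.1, hlam.2, hle.trans (hcoeff rho hrho h0).le⟩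
        · exact Finset.mem_filter.2 ⟨hlam.1, lam, hlam.1, hlam.2, le_rfl⟩
        · intro h
          obtain ⟨_, rho, hrho, h0, hle⟩ := Finset.mem_filter.1 h
          exact absurd (hcoeff rho hrho h0) (not_lt.2 hle)
      have hdeg : ∀ m, MvPowerSeries.coeff m (f - r • dualGrothendieck K lam ⊥) ≠ 0 →
          m.degree ≤ D := by
        intro m hm
        by_contra hlt
        refine hm ?_
        rw [map_sub, map_smul, not_imp_comm.1 (hD m) hlt, not_imp_comm.1
          (degree_le_of_coeff_dualGrothendieck_ne_zero K)
          (fun h => hlt (h.trans ((hS lam).1 hlam.1))), smul_zero, sub_zero]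
      obtain ⟨a, ha⟩ := ih _ hcard (hf.sub (hg.smul r)) hdeg rfl
      refine ⟨a + Finsupp.single lam r, ?_⟩
      rw [isExpansion_iff] at ha ⊢
      rw [map_add, ← ha, Finsupp.linearCombination_single, sub_add_cancel]
    -- With all coefficients at partition exponents in `S` zero, symmetry and the degree bound force
    -- `f = 0`.
    · refine ⟨0, ?_⟩
      rw [isExpansion_iff, map_zero]
      ext m
      rw [map_zero]
      by_contra h0
      obtain ⟨lam, h1, h2⟩ := hf.exists_coeff_eq_coeff_rowExponent m
      refine hne ⟨lam, Finset.mem_filter.2 ⟨(hS lam).2 ?_, h2 ▸ h0⟩⟩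
      rw [← degree_rowExponent, h1]
      exact hD m h0

theorem existsUnique_isExpansion {f : MvPowerSeries ℕ K} (hf : IsSymmetricSeries f)
    {D : ℕ} (hD : ∀ m, MvPowerSeries.coeff m f ≠ 0 → m.degree ≤ D) :
    ∃! a : YoungDiagram →₀ K, IsExpansion f a := by
  obtain ⟨a, ha⟩ := hf.exists_isExpansion hD
  exact ⟨a, ha, fun b hb => linearIndependent_dualGrothendieck K (hb.symm.trans ha)⟩

end Expansion

/-! ### Restriction to the single variable `x_0`. -/

section Specialization

variable {K : Type*} [CommRing K]

/-- With no letter other than `0` allowed, the chain must jump from `mu` to `lam` in its first step.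
-/
theorem coeff_single_zero_dualGrothendieck {lam mu : YoungDiagram} (hle : mu ≤ lam) (n : ℕ) :
    MvPowerSeries.coeff (Finsupp.single 0 n) (dualGrothendieck K lam mu) =
      if numColumns lam mu = n then 1 else 0 := by
  rw [coeff_dualGrothendieck K hle]
  have hself : ∀ α : YoungDiagram, numColumns α α = 0 := fun α => by
    simp [numColumns, skewCells]
  have key : ∀ ν, IsGrowthChain lam mu (Finsupp.single 0 n) ν →
      ν = fun k => if k = 0 then mu else lam := by
    intro ν hν
    have hstep : ∀ k, ν (k + 2) = ν (k + 1) := fun k => by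
      refine le_antisymm ?_ (hν.mono (by omega))
      have h := hν.numColumns_eq (k + 1)
      rw [Finsupp.single_eq_of_ne (by omega), numColumns, Finset.card_eq_zero,
        Finset.image_eq_empty] at h
      exact YoungDiagram.cells_subset_iff.1 (Finset.sdiff_eq_empty_iff_subset.1 h)
    have hconst : ∀ k, ν (k + 1) = ν 1 := fun k => by
      induction k with
      | zero => rfl
      | succ k ih => rw [hstep, ih]
    obtain ⟨N, hN⟩ := hν.eventually_eq
    funext k
    cases k with
    | zero => exact hν.zero
    | succ k => rw [if_neg k.succ_ne_zero, hconst, ← hconst N, hN _ N.le_succ]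
  split_ifs with h
  · rw [Set.ncard_eq_one (s := {ν | IsGrowthChain lam mu (Finsupp.single 0 n) ν}).2
      ⟨_, Set.eq_singleton_iff_unique_mem.2 ⟨?_, key⟩⟩, Nat.cast_one]
    refine ⟨if_pos rfl, monotone_nat_of_le_succ fun k => ?_, ⟨1, fun k hk => if_neg (by omega)⟩,
      fun k => ?_⟩
    · rw [if_neg k.succ_ne_zero]
      split_ifs
      exacts [hle, le_rfl]
    · rw [if_neg k.succ_ne_zero]
      split_ifs with hk
      · rw [hk, h, Finsupp.single_eq_same]
      · rw [hself, Finsupp.single_eq_of_ne hk]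
  · rw [Set.eq_empty_of_forall_notMem (s := {ν | IsGrowthChain lam mu (Finsupp.single 0 n) ν}) ?_,
      Set.ncard_empty, Nat.cast_zero]
    intro ν hν
    refine h ?_
    have h0 := IsGrowthChain.numColumns_eq hν 0
    rw [key ν hν] at h0
    simpa using h0

theorem IsExpansion.sum_eq {f : MvPowerSeries ℕ K} {a : YoungDiagram →₀ K} (ha : IsExpansion f a)
    {C : ℕ} (hf : ∀ n, MvPowerSeries.coeff (Finsupp.single 0 n) f = if C = n then 1 else 0) :
    a.sum (fun _ r => r) = 1 ∧
      ∀ t : K, t ^ C = a.sum (fun lam r => r * t ^ numColumns lam ⊥) := by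
  -- The coefficient of `x_0 ^ n` collects the `a lam` over all `lam` with `n` columns.
  have hmap : a.mapDomain (fun lam => numColumns lam ⊥) = Finsupp.single C 1 := by
    ext n
    rw [Finsupp.single_apply, ← hf n, ha, Finsupp.mapDomain, Finsupp.sum_apply, Finsupp.sum,
      Finsupp.sum, map_sum]
    refine Finset.sum_congr rfl fun lam _ => ?_
    rw [map_smul, coeff_single_zero_dualGrothendieck bot_le, Finsupp.single_apply]
    simp
  have hsum : ∀ t : K, t ^ C = a.sum (fun lam r => r * t ^ numColumns lam ⊥) := fun t => by
    rw [← Finsupp.sum_mapDomain_index (f := fun lam => numColumns lam ⊥)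
      (h := fun n r => r * t ^ n) (fun _ => zero_mul _) (fun _ _ _ => add_mul _ _ _), hmap,
      Finsupp.sum_single_index (zero_mul _), one_mul]
  exact ⟨by simpa using (hsum 1).symm, hsum⟩

/-- Every splitting of a power of `x_0` is into powers of `x_0`, so keeping only these coefficients
is multiplicative. -/
theorem coeff_single_zero_mul {f g : MvPowerSeries ℕ K} {A B : ℕ}
    (hf : ∀ n, MvPowerSeries.coeff (Finsupp.single 0 n) f = if A = n then 1 else 0)
    (hg : ∀ n, MvPowerSeries.coeff (Finsupp.single 0 n) g = if B = n then 1 else 0) (n : ℕ) :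
    MvPowerSeries.coeff (Finsupp.single 0 n) (f * g) = if A + B = n then 1 else 0 := by
  classical
  rw [MvPowerSeries.coeff_mul, Finsupp.antidiagonal_single, Finset.sum_map]
  simp only [Function.Embedding.prodMap, Function.Embedding.coeFn_mk, Prod.map,
    hf, hg, ← ite_and, ite_mul, one_mul, zero_mul]
  split_ifs with h
  · rw [Finset.sum_eq_single (A, B)]
    · simp
    · rintro ⟨i, j⟩ _ hne
      refine if_neg fun h' => hne ?_
      rw [h'.1, h'.2]
    · intro h'
      exact absurd (Finset.HasAntidiagonal.mem_antidiagonal.2 h) h'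
  · refine Finset.sum_eq_zero fun p hp => if_neg fun h' => h ?_
    rw [h'.1, h'.2, Finset.HasAntidiagonal.mem_antidiagonal.1 hp]

end Specialization

theorem mainTheorem12 {K : Type*} [CommRing K] :
    (∀ mu nu : YoungDiagram,
      (∃! d : YoungDiagram →₀ K,
        IsExpansion (dualGrothendieck K mu ⊥ * dualGrothendieck K nu ⊥) d) ∧
      ∀ d : YoungDiagram →₀ K,
        IsExpansion (dualGrothendieck K mu ⊥ * dualGrothendieck K nu ⊥) d →
          d.sum (fun _ r => r) = 1 ∧
          ∀ t : K, t ^ (numColumns mu ⊥ + numColumns nu ⊥) =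
            d.sum (fun lam r => r * t ^ numColumns lam ⊥)) ∧
    (∀ lam mu : YoungDiagram, mu ≤ lam →
      (∃! c : YoungDiagram →₀ K, IsExpansion (dualGrothendieck K lam mu) c) ∧
      ∀ c : YoungDiagram →₀ K, IsExpansion (dualGrothendieck K lam mu) c →
          c.sum (fun _ r => r) = 1 ∧
          ∀ t : K, t ^ numColumns lam mu =
            c.sum (fun nu r => r * t ^ numColumns nu ⊥)) := by
  refine ⟨fun mu nu => ⟨?_, fun d hd => ?_⟩, fun lam mu hle => ⟨?_, fun c hc => ?_⟩⟩
  · refine existsUnique_isExpansion ((isSymmetricSeries_dualGrothendieck bot_le).mul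
      (isSymmetricSeries_dualGrothendieck bot_le)) (D := mu.card + nu.card) fun m hm => ?_
    classical
    rw [MvPowerSeries.coeff_mul] at hm
    obtain ⟨p, hp, h⟩ := Finset.exists_ne_zero_of_sum_ne_zero hm
    rw [← Finset.HasAntidiagonal.mem_antidiagonal.1 hp, map_add]
    exact add_le_add (degree_le_of_coeff_dualGrothendieck_ne_zero K (left_ne_zero_of_mul h))
      (degree_le_of_coeff_dualGrothendieck_ne_zero K (right_ne_zero_of_mul h))
  · exact hd.sum_eq (coeff_single_zero_mul (coeff_single_zero_dualGrothendieck bot_le)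
      (coeff_single_zero_dualGrothendieck bot_le))
  · exact existsUnique_isExpansion (isSymmetricSeries_dualGrothendieck hle)
      fun m => degree_le_of_coeff_dualGrothendieck_ne_zero K
  · exact hc.sum_eq (coeff_single_zero_dualGrothendieck hle)
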